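/- **Theorem 4.6 (gluing deflation factorization systems).** An *extriangulated category* means an additive category $\mathscr C$ with a biadditive functor $\mathbb E:\mathscr C^{op}\times\mathscr C\to Ab$ and an additive realization $\mathfrak s$ satisfying the axioms (ET1)–(ET4), (ET3)$^{op}$, (ET4)$^{op}$ of Nakaoka and Palu; the members $X\xrightarrow{x}Y\xrightarrow{y}Z$ of the classes $\mathfrak s(\delta)$, $\delta\in\mathbb E(Z,X)$, are the conflations; then $x$ is called an inflation, $y$ a deflation, and $X=\operatorname{cocone}(y)$ (unique up to isomorphism). An object $P$ is projective if every morphism from $P$ to $Z$ factors through every deflation $Y\to Z$; $\mathscr C$ has enough projectives if for every object $Z$ there is a deflation $P\to Z$ with $P$ projective. A *negative first extension structure* on $\mathscr C$ consists of a biadditive functor $\mathbb E^{-1}:\mathscr C^{op}\times\mathscr C\to Ab$ and, for each $\delta\in\mathbb E(Z,X)$, natural transformations $\mathbb E^{-1}(-,Z)\to\mathscr C(-,X)$ and $\mathbb E^{-1}(X,-)\to\mathscr C(Z,-)$, such that for every $X\xrightarrow{x}Y\xrightarrow{y}Z$ realizing $\delta$ and every object $W$ the sequences $$\mathbb E^{-1}(W,X)\to\mathbb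 E^{-1}(W,Y)\to\mathbb E^{-1}(W,Z)\to\mathscr C(W,X)\to\mathscr C(W,Y),$$ $$\mathbb E^{-1}(Z,W)\to\mathbb E^{-1}(Y,W)\to\mathbb E^{-1}(X,W)\to\mathscr C(Z,W)\to\mathscr C(Y,W)$$ are exact. It is *balanced* if $\mathbb E^{-1}(-,P)=0$ for every projective $P$. For deflations $l,r$ write $l\perp r$ if $\mathscr C(\operatorname{cocone}l,\operatorname{cocone}r)=0$ and $\mathbb E^{-1}(\operatorname{cocone}l,\operatorname{cocone}r)=0$. A pair $(\mathcal L,\mathcal R)$ of classes of deflations is a *deflation factorization system* if every deflation $f$ factors as $f=rl$ with $l\in\mathcal L$, $r\in\mathcal R$, if $\mathcal L$ is the class of all deflations $f$ with $f\perp g$ for all $g\in\mathcal R$, and if $\mathcal R$ is the class of all deflations $g$ with $f\perp g$ for all $f\in\mathcal L$. An additive functor $F$ between extriangulated categories is *exact* if there is a natural transformation $\eta:\mathbb E(-,-)\to\mathbb E'(F-,F-)$ such that $F$ maps sequences realizing $\delta$ to sequences realizing $\eta(\delta)$. Call a morphism *compatible* if it is an isomorphism whenever it is both an inflation and a deflation.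 A sequence $X\xrightarrow{f}Y\xrightarrow{g}Z$ is *right exact* if $f=h_2h_1$ with $h_1$ a compatible deflation and $K\xrightarrow{h_2}Y\xrightarrow{g}Z$ a conflation; it is *left exact* if $g=h_2h_1$ with $X\xrightarrow{f}Y\xrightarrow{h_1}K$ a conflation and $h_2$ a compatible inflation. An additive functor is *right (left) exact* if it preserves compatible morphisms and right (left) exact sequences. A sequence $X\xrightarrow{f}Y\xrightarrow{g}Z\xrightarrow{h}W$ is *right (left) exact* if there are conflations $X\xrightarrow{f}Y\xrightarrow{g_1}K$ and $K\xrightarrow{g_2}Z\xrightarrow{h}W$ with $g=g_2g_1$ and $g_1$ (respectively $g_2$) compatible. A *recollement* $(\mathcal A,\mathcal B,\mathcal C)$ of extriangulated categories (in the sense of Wang, Wei and Zhang) consists of exact functors $i_*:\mathcal A\to\mathcal B$, $j^*:\mathcal B\to\mathcal C$, right exact functors $i^*:\mathcal B\to\mathcal A$, $j_!:\mathcal C\to\mathcal B$ and left exact functors $i^!:\mathcal B\to\mathcal A$, $j_*:\mathcal C\to\mathcal B$ such that $(i^*,i_*,i^!)$ and $(j_!,j^*,j_*)$ are adjoint triples;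 the essential image of $i_*$ is the kernel of $j^*$; $i_*,j_!,j_*$ are fully faithful; and for each $X\in\mathcal B$ there are, with the first two maps of the former and the last two maps of the latter given by the adjunctions, a left exact sequence $i_*i^!X\to X\to j_*j^*X\to i_*A$ and a right exact sequence $i_*A'\to j_!j^*X\to X\to i_*i^*X$ for some $A,A'\in\mathcal A$. **Statement.** Let $(\mathcal A,\mathcal B,\mathcal C)$ be a recollement of extriangulated categories, each equipped with a balanced negative first extension structure, and suppose that $\mathcal B$ has enough projectives. Let $(\mathcal E_1,\mathcal M_1)$ and $(\mathcal E_2,\mathcal M_2)$ be deflation factorization systems in $\mathcal A$ and $\mathcal C$, respectively. Set $$\mathcal E=\{f \text{ a deflation in }\mathcal B\mid i^*f\in\mathcal E_1,\ j^*f\in\mathcal E_2\},\qquad \mathcal M=\{g\text{ a deflation in }\mathcal B\mid i^!g\in\mathcal M_1,\ j^*g\in\mathcal M_2\}.$$ If $i^*$ and $i^!$ are exact and $i^!$ preserves projective objects, then $(\mathcal E,\mathcal M)$ is a deflation factorization system in $\mathcal B$. -/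

import Mathlib

open CategoryTheory CategoryTheory.Limits Opposite

universe w w' w₁ w₂ w₃ w₁' w₂' w₃' v v₁ v₂ v₃ u u₁ u₂ u₃

namespace Extri

section Bifunctor

variable {𝒞 : Type u} [Category.{v} 𝒞]

/-- The group `E(Z, X)` of a bifunctor `E : 𝒞ᵒᵖ × 𝒞 → Ab` (written in curried form). -/
abbrev Ext (E : 𝒞ᵒᵖ ⥤ 𝒞 ⥤ AddCommGrpCat.{w}) (Z X : 𝒞) : Type w :=
  (E.obj (op Z)).obj X

/-- `a_* = E(Z, a)`. -/
def push (E : 𝒞ᵒᵖ ⥤ 𝒞 ⥤ AddCommGrpCat.{w}) {Z X X' : 𝒞} (a : X ⟶ X') :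
    Ext E Z X →+ Ext E Z X' :=
  ((E.obj (op Z)).map a).hom

/-- `c^* = E(c, X)`. -/
def pull (E : 𝒞ᵒᵖ ⥤ 𝒞 ⥤ AddCommGrpCat.{w}) {Z Z' X : 𝒞} (c : Z' ⟶ Z) :
    Ext E Z X →+ Ext E Z' X :=
  ((E.map c.op).app X).hom

/-- The sum `δ ⊕ δ' ∈ E(Z ⊕ Z', X ⊕ X')`: the extension with components `(δ, 0, 0, δ')`. -/
noncomputable def extSum [Preadditive 𝒞] [HasZeroObject 𝒞] [HasBinaryBiproducts 𝒞]
    (E : 𝒞ᵒᵖ ⥤ 𝒞 ⥤ AddCommGrpCat.{w}) {Z Z' X X' : 𝒞} (δ : Ext E Z X) (δ' : Ext E Z' X') :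
    Ext E (Z ⊞ Z') (X ⊞ X') :=
  push E biprod.inl (pull E biprod.fst δ) + push E biprod.inr (pull E biprod.snd δ')

end Bifunctor

/-- An extriangulated structure `(𝔼, 𝔰)` on an additive category. The equivalence class `𝔰(δ)` is
given by its members: `Realizes δ x y` says that the sequence `X ⟶ Y ⟶ Z` with morphisms `x, y`
belongs to `𝔰(δ)`. -/
structure Extriangulated (𝒞 : Type u) [Category.{v} 𝒞] [Preadditive 𝒞]
    [HasZeroObject 𝒞] [HasBinaryBiproducts 𝒞] where
  /-- The bifunctor of extensions. -/
  E : 𝒞ᵒᵖ ⥤ 𝒞 ⥤ AddCommGrpCat.{w}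
  /-- (ET1): the bifunctor is additive in each variable. -/
  additive_left : E.Additive
  additive_right : ∀ Z : 𝒞ᵒᵖ, (E.obj Z).Additive
  /-- Membership in the equivalence class `𝔰(δ)`. -/
  Realizes : ∀ {X Y Z : 𝒞}, Ext E Z X → (X ⟶ Y) → (Y ⟶ Z) → Prop
  exists_realizes : ∀ {X Z : 𝒞} (δ : Ext E Z X),
    ∃ (Y : 𝒞) (x : X ⟶ Y) (y : Y ⟶ Z), Realizes δ x y
  /-- Two members of `𝔰(δ)` are equivalent. -/
  equiv_of_realizes : ∀ {X Y Y' Z : 𝒞} {δ : Ext E Z X} {x : X ⟶ Y} {y : Y ⟶ Z}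
    {x' : X ⟶ Y'} {y' : Y' ⟶ Z}, Realizes δ x y → Realizes δ x' y' →
    ∃ b : Y ≅ Y', x ≫ b.hom = x' ∧ b.hom ≫ y' = y
  /-- A sequence equivalent to a member of `𝔰(δ)` is a member. -/
  realizes_of_equiv : ∀ {X Y Y' Z : 𝒞} {δ : Ext E Z X} {x : X ⟶ Y} {y : Y ⟶ Z}
    {x' : X ⟶ Y'} {y' : Y' ⟶ Z} (b : Y ≅ Y'), Realizes δ x y →
    x ≫ b.hom = x' → b.hom ≫ y' = y → Realizes δ x' y'
  /-- (ET2), realization: every morphism of extensions lifts to the middle terms. -/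
  realization : ∀ {X Y Z X' Y' Z' : 𝒞} {δ : Ext E Z X} {δ' : Ext E Z' X'}
    {x : X ⟶ Y} {y : Y ⟶ Z} {x' : X' ⟶ Y'} {y' : Y' ⟶ Z'} (a : X ⟶ X') (c : Z ⟶ Z'),
    push E a δ = pull E c δ' → Realizes δ x y → Realizes δ' x' y' →
    ∃ b : Y ⟶ Y', x ≫ b = a ≫ x' ∧ y ≫ c = b ≫ y'
  /-- (ET2), additivity. -/
  realizes_zero : ∀ X Z : 𝒞,
    Realizes (0 : Ext E Z X) (biprod.inl : X ⟶ X ⊞ Z) (biprod.snd : X ⊞ Z ⟶ Z)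
  realizes_sum : ∀ {X Y Z X' Y' Z' : 𝒞} {δ : Ext E Z X} {δ' : Ext E Z' X'}
    {x : X ⟶ Y} {y : Y ⟶ Z} {x' : X' ⟶ Y'} {y' : Y' ⟶ Z'},
    Realizes δ x y → Realizes δ' x' y' →
    Realizes (extSum E δ δ') (biprod.map x x') (biprod.map y y')
  ET3 : ∀ {X Y Z X' Y' Z' : 𝒞} {δ : Ext E Z X} {δ' : Ext E Z' X'}
    {x : X ⟶ Y} {y : Y ⟶ Z} {x' : X' ⟶ Y'} {y' : Y' ⟶ Z'} (a : X ⟶ X') (b : Y ⟶ Y'),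
    Realizes δ x y → Realizes δ' x' y' → x ≫ b = a ≫ x' →
    ∃ c : Z ⟶ Z', y ≫ c = b ≫ y' ∧ push E a δ = pull E c δ'
  ET3op : ∀ {X Y Z X' Y' Z' : 𝒞} {δ : Ext E Z X} {δ' : Ext E Z' X'}
    {x : X ⟶ Y} {y : Y ⟶ Z} {x' : X' ⟶ Y'} {y' : Y' ⟶ Z'} (b : Y ⟶ Y') (c : Z ⟶ Z'),
    Realizes δ x y → Realizes δ' x' y' → y ≫ c = b ≫ y' →
    ∃ a : X ⟶ X', x ≫ b = a ≫ x' ∧ push E a δ = pull E c δ'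
  ET4 : ∀ {X₁ X₂ X₃ D F : 𝒞} {δ : Ext E D X₁} {δ' : Ext E F X₂}
    {f : X₁ ⟶ X₂} {f' : X₂ ⟶ D} {g : X₂ ⟶ X₃} {g' : X₃ ⟶ F},
    Realizes δ f f' → Realizes δ' g g' →
    ∃ (G : 𝒞) (h' : X₃ ⟶ G) (d : D ⟶ G) (e : G ⟶ F) (δ'' : Ext E G X₁),
      Realizes δ'' (f ≫ g) h' ∧ g ≫ h' = f' ≫ d ∧ h' ≫ e = g' ∧
      Realizes (push E f' δ') d e ∧ pull E d δ'' = δ ∧ push E f δ'' = pull E e δ'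
  ET4op : ∀ {X₁ X₂ X₃ D F : 𝒞} {δ : Ext E X₂ D} {δ' : Ext E X₃ F}
    {f' : D ⟶ X₁} {f : X₁ ⟶ X₂} {g' : F ⟶ X₂} {g : X₂ ⟶ X₃},
    Realizes δ f' f → Realizes δ' g' g →
    ∃ (G : 𝒞) (h' : G ⟶ X₁) (d : D ⟶ G) (e : G ⟶ F) (δ'' : Ext E X₃ G),
      Realizes δ'' h' (f ≫ g) ∧ h' ≫ f = e ≫ g' ∧ d ≫ h' = f' ∧
      Realizes (pull E g' δ) d e ∧ push E e δ'' = δ' ∧ push E d δ = pull E g δ''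

namespace Extriangulated

variable {𝒞 : Type u} [Category.{v} 𝒞] [Preadditive 𝒞] [HasZeroObject 𝒞] [HasBinaryBiproducts 𝒞]

/-- `X ⟶ Y ⟶ Z` is a conflation. -/
def Conflation (S : Extriangulated.{w} 𝒞) {X Y Z : 𝒞} (x : X ⟶ Y) (y : Y ⟶ Z) : Prop :=
  ∃ δ : Ext S.E Z X, S.Realizes δ x y

def Inflation (S : Extriangulated.{w} 𝒞) {X Y : 𝒞} (x : X ⟶ Y) : Prop :=
  ∃ (Z : 𝒞) (y : Y ⟶ Z), S.Conflation x y

def Deflation (S : Extriangulated.{w} 𝒞) {Y Z : 𝒞} (y : Y ⟶ Z) : Prop :=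
  ∃ (X : 𝒞) (x : X ⟶ Y), S.Conflation x y

/-- `K` is a cocone of `f` (it is unique up to isomorphism). -/
def IsCocone (S : Extriangulated.{w} 𝒞) {Y Z : 𝒞} (K : 𝒞) (f : Y ⟶ Z) : Prop :=
  ∃ k : K ⟶ Y, S.Conflation k f

def IsProjective (S : Extriangulated.{w} 𝒞) (P : 𝒞) : Prop :=
  ∀ ⦃X Y Z : 𝒞⦄ (x : X ⟶ Y) (y : Y ⟶ Z), S.Conflation x y →
    ∀ c : P ⟶ Z, ∃ b : P ⟶ Y, b ≫ y = c

def EnoughProjectives (S : Extriangulated.{w} 𝒞) : Prop :=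
  ∀ Z : 𝒞, ∃ (X P : 𝒞) (x : X ⟶ P) (y : P ⟶ Z), S.Conflation x y ∧ S.IsProjective P

/-- A morphism is compatible if it is an isomorphism whenever it is both an inflation and a
deflation. -/
def Compatible (S : Extriangulated.{w} 𝒞) {X Y : 𝒞} (f : X ⟶ Y) : Prop :=
  S.Inflation f → S.Deflation f → IsIso f

/-- `X ⟶ Y ⟶ Z` is right exact: `f` is a compatible deflation onto a cocone of `g`. -/
def RightExactSeq (S : Extriangulated.{w} 𝒞) {X Y Z : 𝒞} (f : X ⟶ Y) (g : Y ⟶ Z) : Prop :=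
  ∃ (K : 𝒞) (h₁ : X ⟶ K) (h₂ : K ⟶ Y),
    S.Conflation h₂ g ∧ S.Deflation h₁ ∧ S.Compatible h₁ ∧ f = h₁ ≫ h₂

/-- `X ⟶ Y ⟶ Z` is left exact: `g` is a compatible inflation from a cone of `f`. -/
def LeftExactSeq (S : Extriangulated.{w} 𝒞) {X Y Z : 𝒞} (f : X ⟶ Y) (g : Y ⟶ Z) : Prop :=
  ∃ (K : 𝒞) (h₁ : Y ⟶ K) (h₂ : K ⟶ Z),
    S.Conflation f h₁ ∧ S.Inflation h₂ ∧ S.Compatible h₂ ∧ g = h₁ ≫ h₂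

/-- A right exact four-term sequence `X ⟶ Y ⟶ Z ⟶ W`. -/
def RightExactSeq₄ (S : Extriangulated.{w} 𝒞) {X Y Z W : 𝒞}
    (f : X ⟶ Y) (g : Y ⟶ Z) (h : Z ⟶ W) : Prop :=
  ∃ (K : 𝒞) (g₁ : Y ⟶ K) (g₂ : K ⟶ Z),
    S.Conflation f g₁ ∧ S.Conflation g₂ h ∧ g = g₁ ≫ g₂ ∧ S.Compatible g₁

/-- A left exact four-term sequence `X ⟶ Y ⟶ Z ⟶ W`. -/
def LeftExactSeq₄ (S : Extriangulated.{w} 𝒞) {X Y Z W : 𝒞}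
    (f : X ⟶ Y) (g : Y ⟶ Z) (h : Z ⟶ W) : Prop :=
  ∃ (K : 𝒞) (g₁ : Y ⟶ K) (g₂ : K ⟶ Z),
    S.Conflation f g₁ ∧ S.Conflation g₂ h ∧ g = g₁ ≫ g₂ ∧ S.Compatible g₂

end Extriangulated

section Functors

variable {𝒜 : Type u₁} [Category.{v₁} 𝒜] [Preadditive 𝒜] [HasZeroObject 𝒜] [HasBinaryBiproducts 𝒜]
  {ℬ : Type u₂} [Category.{v₂} ℬ] [Preadditive ℬ] [HasZeroObject ℬ] [HasBinaryBiproducts ℬ]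

/-- An exact functor: an additive functor `F` for which there is a natural transformation
`η : E_𝒜(-, -) ⟶ E_ℬ(F -, F -)` such that `F` maps realizations of `δ` to realizations of
`η δ`. -/
structure IsExact (S : Extriangulated.{w₁} 𝒜) (T : Extriangulated.{w₂} ℬ) (F : 𝒜 ⥤ ℬ) :
    Prop where
  additive : F.Additive
  exists_eta : ∃ η : ∀ Z X : 𝒜, Ext S.E Z X →+ Ext T.E (F.obj Z) (F.obj X),
    (∀ {Z X X' : 𝒜} (a : X ⟶ X') (δ : Ext S.E Z X),
      η Z X' (push S.E a δ) = push T.E (F.map a) (η Z X δ)) ∧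
    (∀ {Z Z' X : 𝒜} (c : Z' ⟶ Z) (δ : Ext S.E Z X),
      η Z' X (pull S.E c δ) = pull T.E (F.map c) (η Z X δ)) ∧
    (∀ {X Y Z : 𝒜} (δ : Ext S.E Z X) (x : X ⟶ Y) (y : Y ⟶ Z),
      S.Realizes δ x y → T.Realizes (η Z X δ) (F.map x) (F.map y))

structure IsRightExact (S : Extriangulated.{w₁} 𝒜) (T : Extriangulated.{w₂} ℬ) (F : 𝒜 ⥤ ℬ) :
    Prop where
  additive : F.Additive
  compatible : ∀ {X Y : 𝒜} (f : X ⟶ Y), S.Compatible f → T.Compatible (F.map f)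
  rightExactSeq : ∀ {X Y Z : 𝒜} (f : X ⟶ Y) (g : Y ⟶ Z),
    S.RightExactSeq f g → T.RightExactSeq (F.map f) (F.map g)

structure IsLeftExact (S : Extriangulated.{w₁} 𝒜) (T : Extriangulated.{w₂} ℬ) (F : 𝒜 ⥤ ℬ) :
    Prop where
  additive : F.Additive
  compatible : ∀ {X Y : 𝒜} (f : X ⟶ Y), S.Compatible f → T.Compatible (F.map f)
  leftExactSeq : ∀ {X Y Z : 𝒜} (f : X ⟶ Y) (g : Y ⟶ Z),
    S.LeftExactSeq f g → T.LeftExactSeq (F.map f) (F.map g)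

def PreservesProjectives (S : Extriangulated.{w₁} 𝒜) (T : Extriangulated.{w₂} ℬ)
    (F : 𝒜 ⥤ ℬ) : Prop :=
  ∀ P : 𝒜, S.IsProjective P → T.IsProjective (F.obj P)

end Functors

section Negative

variable {𝒞 : Type u} [Category.{v} 𝒞] [Preadditive 𝒞] [HasZeroObject 𝒞] [HasBinaryBiproducts 𝒞]

/-- A negative first extension structure on an extriangulated category. -/
structure NegFirstExt (S : Extriangulated.{w} 𝒞) where
  /-- The bifunctor `𝔼⁻¹`. -/
  N : 𝒞ᵒᵖ ⥤ 𝒞 ⥤ AddCommGrpCat.{w'}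
  additive_left : N.Additive
  additive_right : ∀ Z : 𝒞ᵒᵖ, (N.obj Z).Additive
  /-- The transformation `δ_♯⁻¹ : 𝔼⁻¹(-, Z) ⟶ 𝒞(-, X)` attached to `δ ∈ 𝔼(Z, X)`. -/
  sharpCov : ∀ {X Z : 𝒞} (_ : Ext S.E Z X) (W : 𝒞), Ext N W Z →+ (W ⟶ X)
  sharpCov_natural : ∀ {X Z : 𝒞} (δ : Ext S.E Z X) {W W' : 𝒞} (c : W' ⟶ W) (e : Ext N W Z),
    sharpCov δ W' (pull N c e) = c ≫ sharpCov δ W e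
  /-- The transformation `δ^♯₋₁ : 𝔼⁻¹(X, -) ⟶ 𝒞(Z, -)` attached to `δ ∈ 𝔼(Z, X)`. -/
  sharpContra : ∀ {X Z : 𝒞} (_ : Ext S.E Z X) (W : 𝒞), Ext N X W →+ (Z ⟶ W)
  sharpContra_natural : ∀ {X Z : 𝒞} (δ : Ext S.E Z X) {W W' : 𝒞} (a : W ⟶ W') (e : Ext N X W),
    sharpContra δ W' (push N a e) = sharpContra δ W e ≫ a
  /-- `𝔼⁻¹(W,X) → 𝔼⁻¹(W,Y) → 𝔼⁻¹(W,Z) → 𝒞(W,X) → 𝒞(W,Y)` is exact. -/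
  exact_cov : ∀ {X Y Z : 𝒞} (δ : Ext S.E Z X) (x : X ⟶ Y) (y : Y ⟶ Z),
    S.Realizes δ x y → ∀ W : 𝒞,
      Function.Exact (push N x : Ext N W X →+ Ext N W Y) (push N y : Ext N W Y →+ Ext N W Z) ∧
      Function.Exact (push N y : Ext N W Y →+ Ext N W Z) (sharpCov δ W) ∧
      Function.Exact (sharpCov δ W) (fun t : W ⟶ X => t ≫ x)
  /-- `𝔼⁻¹(Z,W) → 𝔼⁻¹(Y,W) → 𝔼⁻¹(X,W) → 𝒞(Z,W) → 𝒞(Y,W)` is exact. -/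
  exact_contra : ∀ {X Y Z : 𝒞} (δ : Ext S.E Z X) (x : X ⟶ Y) (y : Y ⟶ Z),
    S.Realizes δ x y → ∀ W : 𝒞,
      Function.Exact (pull N y : Ext N Z W →+ Ext N Y W) (pull N x : Ext N Y W →+ Ext N X W) ∧
      Function.Exact (pull N x : Ext N Y W →+ Ext N X W) (sharpContra δ W) ∧
      Function.Exact (sharpContra δ W) (fun t : Z ⟶ W => y ≫ t)

variable {S : Extriangulated.{w} 𝒞}

/-- The structure is balanced: `𝔼⁻¹(-, P) = 0` for every projective object `P`. -/
def NegFirstExt.Balanced (n : NegFirstExt.{w, w'} S) : Prop :=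
  ∀ W P : 𝒞, S.IsProjective P → ∀ e : Ext n.N W P, e = 0

/-- Orthogonality `l ⊥ r` of deflations: `𝒞(cocone l, cocone r) = 0` and
`𝔼⁻¹(cocone l, cocone r) = 0`. -/
def DeflOrth (n : NegFirstExt.{w, w'} S) {X Y X' Y' : 𝒞} (l : X ⟶ Y) (r : X' ⟶ Y') : Prop :=
  ∀ K K' : 𝒞, S.IsCocone K l → S.IsCocone K' r →
    (∀ t : K ⟶ K', t = 0) ∧ ∀ e : Ext n.N K K', e = 0

/-- `{g is a deflation | f ⊥ g for every f ∈ J}`. -/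
def deflRightPerp (n : NegFirstExt.{w, w'} S) (J : MorphismProperty 𝒞) : MorphismProperty 𝒞 :=
  fun _ _ g => S.Deflation g ∧ ∀ ⦃X Y : 𝒞⦄ (f : X ⟶ Y), J f → DeflOrth n f g

/-- `{f is a deflation | f ⊥ g for every g ∈ J}`. -/
def deflLeftPerp (n : NegFirstExt.{w, w'} S) (J : MorphismProperty 𝒞) : MorphismProperty 𝒞 :=
  fun _ _ f => S.Deflation f ∧ ∀ ⦃X Y : 𝒞⦄ (g : X ⟶ Y), J g → DeflOrth n f g

/-- Deflation factorization systems. -/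
structure IsDeflFactSystem (n : NegFirstExt.{w, w'} S) (L R : MorphismProperty 𝒞) : Prop where
  left_deflation : ∀ ⦃X Y : 𝒞⦄ (f : X ⟶ Y), L f → S.Deflation f
  right_deflation : ∀ ⦃X Y : 𝒞⦄ (f : X ⟶ Y), R f → S.Deflation f
  factorization : ∀ ⦃X Y : 𝒞⦄ (f : X ⟶ Y), S.Deflation f →
    ∃ (M : 𝒞) (l : X ⟶ M) (r : M ⟶ Y), L l ∧ R r ∧ f = l ≫ r
  left_eq : L = deflLeftPerp n R
  right_eq : deflRightPerp n L = R

end Negative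

/-- A recollement of `ℬ` relative to `𝒜` and `𝒞`. -/
structure Recollement
    {𝒜 : Type u₁} [Category.{v₁} 𝒜] [Preadditive 𝒜] [HasZeroObject 𝒜] [HasBinaryBiproducts 𝒜]
    {ℬ : Type u₂} [Category.{v₂} ℬ] [Preadditive ℬ] [HasZeroObject ℬ] [HasBinaryBiproducts ℬ]
    {𝒞 : Type u₃} [Category.{v₃} 𝒞] [Preadditive 𝒞] [HasZeroObject 𝒞] [HasBinaryBiproducts 𝒞]
    (SA : Extriangulated.{w₁} 𝒜) (SB : Extriangulated.{w₂} ℬ) (SC : Extriangulated.{w₃} 𝒞) where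
  /-- `i^*` -/
  iStar : ℬ ⥤ 𝒜
  /-- `i_*` -/
  iLower : 𝒜 ⥤ ℬ
  /-- `i^!` -/
  iShriek : ℬ ⥤ 𝒜
  /-- `j_!` -/
  jShriek : 𝒞 ⥤ ℬ
  /-- `j^*` -/
  jStar : ℬ ⥤ 𝒞
  /-- `j_*` -/
  jLower : 𝒞 ⥤ ℬ
  exact_iLower : IsExact SA SB iLower
  exact_jStar : IsExact SB SC jStar
  rightExact_iStar : IsRightExact SB SA iStar
  rightExact_jShriek : IsRightExact SC SB jShriek
  leftExact_iShriek : IsLeftExact SB SA iShriek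
  leftExact_jLower : IsLeftExact SC SB jLower
  /-- (R1) -/
  adj_iStar : iStar ⊣ iLower
  adj_iShriek : iLower ⊣ iShriek
  adj_jShriek : jShriek ⊣ jStar
  adj_jLower : jStar ⊣ jLower
  /-- (R2): `Im i_* = Ker j^*` as subcategories closed under isomorphisms. -/
  im_eq_ker : ∀ X : ℬ, (∃ Y : 𝒜, Nonempty (iLower.obj Y ≅ X)) ↔ IsZero (jStar.obj X)
  /-- (R3) -/
  full_iLower : iLower.Full
  faithful_iLower : iLower.Faithful
  full_jShriek : jShriek.Full
  faithful_jShriek : jShriek.Faithful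
  full_jLower : jLower.Full
  faithful_jLower : jLower.Faithful
  /-- (R4): `i_* i^! X ⟶ X ⟶ j_* j^* X ⟶ i_* Y` is left exact for some `Y`. -/
  leftSeq : ∀ X : ℬ, ∃ (Y : 𝒜) (h : jLower.obj (jStar.obj X) ⟶ iLower.obj Y),
    SB.LeftExactSeq₄ (adj_iShriek.counit.app X) (adj_jLower.unit.app X) h
  /-- (R5): `i_* Y ⟶ j_! j^* X ⟶ X ⟶ i_* i^* X` is right exact for some `Y`. -/
  rightSeq : ∀ X : ℬ, ∃ (Y : 𝒜) (h : iLower.obj Y ⟶ jShriek.obj (jStar.obj X)),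
    SB.RightExactSeq₄ h (adj_jShriek.counit.app X) (adj_iStar.unit.app X)

end Extri

/-!
Deflation factorization systems are determined by the cocones of their members, and on cocones
they are torsion pairs `(T, F)` with `𝒞(T, F) = 0` and `𝔼⁻¹(T, F) = 0`
(`IsDeflFactSystem.exists_isTorsionPair`, `IsTorsionPair.isDeflFactSystem`): the torsion conflation
of `K` is a factorization of `K ⟶ 0`, and the octahedral axiom turns the torsion conflation of the
cocone of a deflation into a factorization of it. As `i^*`, `i^!`, `j^*` are exact, they preserve
cocones, so it suffices to glue torsion pairs `(T₁, F₁)` and `(T₂, F₂)` along the recollement, with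
`T = {X | i^* X ∈ T₁, j^* X ∈ T₂}` and `F = {X | i^! X ∈ F₁, j^* X ∈ F₂}`
(`Recollement.isTorsionPair`).

Exactness of `i^*` and `i^!` turns the four-term sequences of the recollement into conflations
`j_! j^* X ⟶ X ⟶ i_* i^* X` and `i_* i^! X ⟶ X ⟶ j_* j^* X`. By the first one, the orthogonality of
`X ∈ T` to `Y ∈ F` reduces to that of `j_! j^* X` and `i_* i^* X` to `Y`. For an adjunction
`L ⊣ G` with `G` exact, it passes from `(A, G Y)` to `(L A, Y)` (`Orth.of_adjunction`): for
morphisms this is the adjunction, and for `𝔼⁻¹` one embeds `𝔼⁻¹(L A, Y)` into `ℬ(L A, Y')` for a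
projective presentation `Y' ⟶ P ⟶ Y`, where `𝔼⁻¹(-, P) = 0` by balancedness.

The torsion conflation of an object `B` is built as for t-structures: remove from `B` first the
torsion-free part of `j^* B`, by a deflation `B ⟶ j_* j^* B ⟶ Q`, then from its cocone `Y` the
torsion-free part of `i^* Y`, by a deflation `Y ⟶ i_* i^* Y ⟶ i_* A₂`. Here `j_*` is used only as a
left exact functor: it sends an inflation with cone `Z` to an inflation whose cone `Q` satisfies
`i^! Q = 0` and `j^* Q ≅ Z` (`Recollement.exists_conflation_jLower`). The identification of cones
and cocones up to isomorphism rests on the five lemma for morphisms of extensions.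
-/

namespace Extri

/-! ### Bifunctors -/

section Bifunctor

variable {𝒞 : Type u} [Category.{v} 𝒞] (E : 𝒞ᵒᵖ ⥤ 𝒞 ⥤ AddCommGrpCat.{w})

lemma push_id {Z X : 𝒞} (δ : Ext E Z X) : push E (𝟙 X) δ = δ := by
  simp [push]

lemma pull_id {Z X : 𝒞} (δ : Ext E Z X) : pull E (𝟙 Z) δ = δ := by
  simp [pull]

lemma push_comp {Z X X' X'' : 𝒞} (a : X ⟶ X') (b : X' ⟶ X'') (δ : Ext E Z X) :
    push E (a ≫ b) δ = push E b (push E a δ) := by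
  simp [push]

lemma pull_comp {Z Z' Z'' X : 𝒞} (a : Z'' ⟶ Z') (b : Z' ⟶ Z) (δ : Ext E Z X) :
    pull E (a ≫ b) δ = pull E a (pull E b δ) := by
  simp [pull]

lemma push_pull {Z Z' X X' : 𝒞} (a : X ⟶ X') (c : Z' ⟶ Z) (δ : Ext E Z X) :
    push E a (pull E c δ) = pull E c (push E a δ) :=
  (ConcreteCategory.congr_hom ((E.map c.op).naturality a) δ).symm

variable [Preadditive 𝒞]

lemma push_zero_map (hE : ∀ Z : 𝒞ᵒᵖ, (E.obj Z).Additive) {Z X X' : 𝒞} (δ : Ext E Z X) :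
    push E (0 : X ⟶ X') δ = 0 := by
  have := hE (op Z)
  simp [push, Functor.map_zero]

lemma pull_zero_map (hE : E.Additive) {Z Z' X : 𝒞} (δ : Ext E Z X) :
    pull E (0 : Z' ⟶ Z) δ = 0 := by
  simp [pull, Functor.map_zero]

lemma push_sub_map (hE : ∀ Z : 𝒞ᵒᵖ, (E.obj Z).Additive) {Z X X' : 𝒞} (a b : X ⟶ X')
    (δ : Ext E Z X) : push E (a - b) δ = push E a δ - push E b δ := by
  have := hE (op Z)
  simp [push, Functor.map_sub]

lemma pull_sub_map (hE : E.Additive) {Z Z' X : 𝒞} (a b : Z' ⟶ Z) (δ : Ext E Z X) :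
    pull E (a - b) δ = pull E a δ - pull E b δ := by
  simp [pull, Functor.map_sub]

lemma ext_eq_zero_of_isZero_left (hE : E.Additive) {Z X : 𝒞} (hZ : IsZero Z) (δ : Ext E Z X) :
    δ = 0 := by
  rw [← pull_id E δ, hZ.eq_of_src (𝟙 Z) 0, pull_zero_map E hE]

lemma ext_eq_zero_of_isZero_right (hE : ∀ Z : 𝒞ᵒᵖ, (E.obj Z).Additive) {Z X : 𝒞}
    (hX : IsZero X) (δ : Ext E Z X) : δ = 0 := by
  rw [← push_id E δ, hX.eq_of_src (𝟙 X) 0, push_zero_map E hE]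

end Bifunctor

/-! ### Exact sequences and the five lemma in an extriangulated category -/

open ZeroObject

namespace Extriangulated

variable {𝒞 : Type u} [Category.{v} 𝒞] [Preadditive 𝒞] [HasZeroObject 𝒞] [HasBinaryBiproducts 𝒞]
  (S : Extriangulated.{w} 𝒞)

lemma realizes_id_zero (X : 𝒞) {Z : 𝒞} (hZ : IsZero Z) :
    S.Realizes (0 : Ext S.E Z X) (𝟙 X) (0 : X ⟶ Z) :=
  S.realizes_of_equiv
    ⟨biprod.fst, biprod.inl, biprod.hom_ext _ _ (by simp) (hZ.eq_of_tgt _ _), by simp⟩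
    (S.realizes_zero X Z) (by simp) (hZ.eq_of_tgt _ _)

lemma realizes_zero_id {X : 𝒞} (hX : IsZero X) (Z : 𝒞) :
    S.Realizes (0 : Ext S.E Z X) (0 : X ⟶ Z) (𝟙 Z) :=
  S.realizes_of_equiv
    ⟨biprod.snd, biprod.inr, biprod.hom_ext _ _ (hX.eq_of_tgt _ _) (by simp), by simp⟩
    (S.realizes_zero X Z) (hX.eq_of_src _ _) (by simp)

lemma isCocone_zero (X : 𝒞) {Z : 𝒞} (hZ : IsZero Z) (f : X ⟶ Z) : S.IsCocone X f := by
  rw [hZ.eq_of_tgt f 0]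
  exact ⟨𝟙 X, 0, S.realizes_id_zero X hZ⟩

variable {S}

section

variable {X Y Z : 𝒞} {δ : Ext S.E Z X} {x : X ⟶ Y} {y : Y ⟶ Z}

lemma Realizes.comp_eq_zero (h : S.Realizes δ x y) : x ≫ y = 0 := by
  obtain ⟨c, hc, -⟩ := S.ET3 (𝟙 X) x (S.realizes_id_zero X (isZero_zero 𝒞)) h rfl
  rw [← hc, zero_comp]

lemma Realizes.pull_eq_zero (h : S.Realizes δ x y) : pull S.E y δ = 0 := by
  obtain ⟨a, -, ha⟩ := S.ET3op (𝟙 Y) y (S.realizes_zero_id (isZero_zero 𝒞) Y) h rfl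
  rw [← ha, map_zero]

lemma Realizes.push_eq_zero (h : S.Realizes δ x y) : push S.E x δ = 0 := by
  obtain ⟨c, -, hc⟩ := S.ET3 x (𝟙 Y) h (S.realizes_id_zero Y (isZero_zero 𝒞)) rfl
  rw [hc, map_zero]

/-- `y` is a weak cokernel of `x`. -/
lemma Realizes.exists_desc (h : S.Realizes δ x y) {W : 𝒞} (t : Y ⟶ W) (ht : x ≫ t = 0) :
    ∃ c : Z ⟶ W, y ≫ c = t := by
  obtain ⟨c, hc, -⟩ := S.ET3 (0 : X ⟶ 0) t h (S.realizes_zero_id (isZero_zero 𝒞) W)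
    (by simpa using ht)
  exact ⟨c, by simpa using hc⟩

/-- `x` is a weak kernel of `y`. -/
lemma Realizes.exists_lift (h : S.Realizes δ x y) {W : 𝒞} (t : W ⟶ Y) (ht : t ≫ y = 0) :
    ∃ a : W ⟶ X, a ≫ x = t := by
  obtain ⟨a, ha, -⟩ := S.ET3op t (0 : 0 ⟶ Z) (S.realizes_id_zero W (isZero_zero 𝒞)) h
    (by simpa using ht.symm)
  exact ⟨a, by simpa using ha.symm⟩

/-- Exactness of `𝒞(W, Y) ⟶ 𝒞(W, Z) ⟶ E(W, X)`. -/
lemma Realizes.exists_lift_of_pull_eq_zero (h : S.Realizes δ x y) {W : 𝒞} (c : W ⟶ Z)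
    (hc : pull S.E c δ = 0) : ∃ b : W ⟶ Y, b ≫ y = c := by
  obtain ⟨b, -, hb⟩ := S.realization (δ := (0 : Ext S.E W X)) (𝟙 X) c
    (by rw [hc, map_zero]) (S.realizes_zero X W) h
  exact ⟨biprod.inr ≫ b, by rw [Category.assoc, ← hb]; simp⟩

/-- Exactness of `𝒞(Y, W) ⟶ 𝒞(X, W) ⟶ E(Z, W)`. -/
lemma Realizes.exists_desc_of_push_eq_zero (h : S.Realizes δ x y) {W : 𝒞} (a : X ⟶ W)
    (ha : push S.E a δ = 0) : ∃ b : Y ⟶ W, x ≫ b = a := by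
  obtain ⟨b, hb, -⟩ := S.realization (δ' := (0 : Ext S.E Z W)) a (𝟙 Z)
    (by rw [ha, map_zero]) h (S.realizes_zero W Z)
  exact ⟨b ≫ biprod.fst, by rw [← Category.assoc, hb]; simp⟩

/-- Exactness of `𝒞(W, Z) ⟶ E(W, X) ⟶ E(W, Y)`. -/
lemma Realizes.exists_pull_eq (h : S.Realizes δ x y) {W : 𝒞} (ε : Ext S.E W X)
    (hε : push S.E x ε = 0) : ∃ c : W ⟶ Z, pull S.E c δ = ε := by
  obtain ⟨M, m, m', hm⟩ := S.exists_realizes ε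
  obtain ⟨b, hb⟩ := Realizes.exists_desc_of_push_eq_zero hm x hε
  obtain ⟨c, -, hc⟩ := S.ET3 (𝟙 X) b hm h (by simpa using hb)
  exact ⟨c, by rw [← hc, push_id]⟩

/-- Exactness of `𝒞(X, W) ⟶ E(Z, W) ⟶ E(Y, W)`. -/
lemma Realizes.exists_push_eq (h : S.Realizes δ x y) {W : 𝒞} (ε : Ext S.E Z W)
    (hε : pull S.E y ε = 0) : ∃ a : X ⟶ W, push S.E a δ = ε := by
  obtain ⟨M, m, m', hm⟩ := S.exists_realizes ε
  obtain ⟨b, hb⟩ := Realizes.exists_lift_of_pull_eq_zero hm y hε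
  obtain ⟨a, -, ha⟩ := S.ET3op b (𝟙 Z) h hm (by simpa using hb.symm)
  exact ⟨a, by rw [ha, pull_id]⟩

variable {X' Y' Z' : 𝒞} {δ' : Ext S.E Z' X'} {x' : X' ⟶ Y'} {y' : Y' ⟶ Z'}

/-- The five lemma for the cones: a morphism of extensions whose components at the first two
terms are isomorphisms is an isomorphism at the third term. -/
lemma Realizes.isIso_third (h : S.Realizes δ x y) (h' : S.Realizes δ' x' y') (a : X ≅ X')
    (b : Y ≅ Y') (c : Z ⟶ Z') (hx : x ≫ b.hom = a.hom ≫ x') (hy : y ≫ c = b.hom ≫ y')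
    (hδ : push S.E a.hom δ = pull S.E c δ') : IsIso c := by
  have hx' : a.inv ≫ x = x' ≫ b.inv := by
    rw [Iso.inv_comp_eq, ← Category.assoc, Iso.eq_comp_inv, hx]
  have hb : ∀ {W : 𝒞} (k : W ⟶ Y'), (k ≫ b.inv ≫ y) ≫ c = k ≫ y' := fun k => by
    simp [hy]
  have hmono : Mono c := by
    refine Preadditive.mono_of_cancel_zero _ fun {W} g hg => ?_
    have hg0 : pull S.E g δ = 0 := by
      rw [← push_id S.E (pull S.E g δ), ← a.hom_inv_id, push_comp, push_pull, hδ, ← pull_comp, hg,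
        pull_zero_map _ S.additive_left, map_zero]
    obtain ⟨k, rfl⟩ := Realizes.exists_lift_of_pull_eq_zero h g hg0
    obtain ⟨k', hk'⟩ := Realizes.exists_lift h' (k ≫ b.hom)
      (by rw [Category.assoc, ← hy, ← Category.assoc, hg])
    have hk : k = k' ≫ a.inv ≫ x := by
      rw [hx', ← Category.assoc, Iso.eq_comp_inv, hk']
    rw [hk, Category.assoc, Category.assoc, Realizes.comp_eq_zero h, comp_zero, comp_zero]
  -- A section of `c`: lift the class `δ'` along `c`, and correct the error by a map through `y'`.
  obtain ⟨s, hs⟩ := Realizes.exists_pull_eq h (push S.E a.inv δ')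
    (by rw [← push_comp, hx', push_comp, Realizes.push_eq_zero h', map_zero])
  have hs' : pull S.E (𝟙 Z' - s ≫ c) δ' = 0 := by
    rw [pull_sub_map _ S.additive_left, pull_id, pull_comp, ← hδ, ← push_pull, hs, ← push_comp,
      a.inv_hom_id, push_id, sub_self]
  obtain ⟨k, hk⟩ := Realizes.exists_lift_of_pull_eq_zero h' _ hs'
  have hsec : (s + k ≫ b.inv ≫ y) ≫ c = 𝟙 Z' := by
    rw [Preadditive.add_comp, hb, hk]; abel
  have : IsSplitEpi c := ⟨⟨_, hsec⟩⟩
  exact isIso_of_mono_of_isSplitEpi c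

/-- The five lemma for the cocones. -/
lemma Realizes.isIso_first (h : S.Realizes δ x y) (h' : S.Realizes δ' x' y') (a : X ⟶ X')
    (b : Y ≅ Y') (c : Z ≅ Z') (hx : x ≫ b.hom = a ≫ x') (hy : y ≫ c.hom = b.hom ≫ y')
    (hδ : push S.E a δ = pull S.E c.hom δ') : IsIso a := by
  have hy' : b.inv ≫ y = y' ≫ c.inv := by
    rw [Iso.inv_comp_eq, ← Category.assoc, Iso.eq_comp_inv, hy]
  have hepi : Epi a := by
    refine Preadditive.epi_of_cancel_zero _ fun {W} g hg => ?_
    have hg0 : push S.E g δ' = 0 := by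
      rw [← pull_id S.E (push S.E g δ'), ← c.inv_hom_id, pull_comp, ← push_pull, ← hδ, ← push_comp,
        hg, push_zero_map _ S.additive_right, map_zero]
    obtain ⟨k, rfl⟩ := Realizes.exists_desc_of_push_eq_zero h' g hg0
    obtain ⟨k', hk'⟩ := Realizes.exists_desc h (b.hom ≫ k)
      (by rw [← Category.assoc, hx, Category.assoc, hg])
    have hk : k = y' ≫ c.inv ≫ k' := by
      rw [← Category.assoc, ← hy', Category.assoc, hk', Iso.inv_hom_id_assoc]
    rw [hk, ← Category.assoc, Realizes.comp_eq_zero h', zero_comp]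
  obtain ⟨s, hs⟩ := Realizes.exists_push_eq h' (pull S.E c.inv δ)
    (by rw [← pull_comp, ← hy', pull_comp, Realizes.pull_eq_zero h, map_zero])
  have hs' : push S.E (𝟙 X - a ≫ s) δ = 0 := by
    rw [push_sub_map _ S.additive_right, push_id, push_comp, hδ, push_pull, hs, ← pull_comp,
      c.hom_inv_id, pull_id, sub_self]
  obtain ⟨k, hk⟩ := Realizes.exists_desc_of_push_eq_zero h _ hs'
  have hret : a ≫ (s + x' ≫ b.inv ≫ k) = 𝟙 X := by
    have : a ≫ x' ≫ b.inv ≫ k = x ≫ k := by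
      rw [← Category.assoc, ← hx]; simp
    rw [Preadditive.comp_add, this, hk]; abel
  have : IsSplitMono a := ⟨⟨_, hret⟩⟩
  exact isIso_of_epi_of_isSplitMono a

end

section

variable {X Y Z X' Y' Z' : 𝒞} {x : X ⟶ Y} {y : Y ⟶ Z} {x' : X' ⟶ Y'} {y' : Y' ⟶ Z'}

lemma Conflation.nonempty_iso_third (h : S.Conflation x y) (h' : S.Conflation x' y') (a : X ≅ X')
    (b : Y ≅ Y') (hx : x ≫ b.hom = a.hom ≫ x') : Nonempty (Z ≅ Z') := by
  obtain ⟨δ, h⟩ := h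
  obtain ⟨δ', h'⟩ := h'
  obtain ⟨c, hc, hδ⟩ := S.ET3 a.hom b.hom h h' hx
  have := Realizes.isIso_third h h' a b c hx hc hδ
  exact ⟨asIso c⟩

lemma Conflation.nonempty_iso_first (h : S.Conflation x y) (h' : S.Conflation x' y') (b : Y ≅ Y')
    (c : Z ≅ Z') (hy : y ≫ c.hom = b.hom ≫ y') : Nonempty (X ≅ X') := by
  obtain ⟨δ, h⟩ := h
  obtain ⟨δ', h'⟩ := h'
  obtain ⟨a, ha, hδ⟩ := S.ET3op b.hom c.hom h h' hy
  have := Realizes.isIso_first h h' a b c ha hy hδ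
  exact ⟨asIso a⟩

/-- Cocones are unique up to isomorphism. -/
lemma IsCocone.nonempty_iso {K K' : 𝒞} {f : Y ⟶ Z} (h : S.IsCocone K f) (h' : S.IsCocone K' f) :
    Nonempty (K ≅ K') := by
  obtain ⟨k, h⟩ := h
  obtain ⟨k', h'⟩ := h'
  exact h.nonempty_iso_first h' (Iso.refl _) (Iso.refl _) (by simp)

lemma Conflation.isZero_first (h : S.Conflation x y) [IsIso y] : IsZero X := by
  obtain ⟨e⟩ := h.nonempty_iso_first ⟨0, S.realizes_zero_id (isZero_zero 𝒞) Z⟩ (asIso y)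
    (Iso.refl Z) (by simp)
  exact (isZero_zero 𝒞).of_iso e

lemma Conflation.isZero_third (h : S.Conflation x y) [IsIso x] : IsZero Z := by
  obtain ⟨e⟩ := h.nonempty_iso_third ⟨0, S.realizes_id_zero Y (isZero_zero 𝒞)⟩ (asIso x)
    (Iso.refl Y) (by simp)
  exact (isZero_zero 𝒞).of_iso e

lemma Conflation.isIso_of_isZero_first (h : S.Conflation x y) (hX : IsZero X) : IsIso y := by
  obtain ⟨δ, h⟩ := h
  rw [ext_eq_zero_of_isZero_right _ S.additive_right hX δ] at h
  obtain ⟨b, -, hb⟩ := S.equiv_of_realizes h (S.realizes_zero_id hX Z)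
  rw [← hb]
  infer_instance

lemma Conflation.isIso_of_isZero_third (h : S.Conflation x y) (hZ : IsZero Z) : IsIso x := by
  obtain ⟨δ, h⟩ := h
  rw [ext_eq_zero_of_isZero_left _ S.additive_left hZ δ] at h
  obtain ⟨b, hb, -⟩ := S.equiv_of_realizes (S.realizes_id_zero X hZ) h
  rw [← hb]
  infer_instance

/-- The octahedral axiom for composed inflations, in terms of conflations. -/
lemma Conflation.octahedron {X₁ X₂ X₃ D F : 𝒞} {f : X₁ ⟶ X₂} {f' : X₂ ⟶ D} {g : X₂ ⟶ X₃}
    {g' : X₃ ⟶ F} (h : S.Conflation f f') (h' : S.Conflation g g') :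
    ∃ (G : 𝒞) (k : X₃ ⟶ G) (d : D ⟶ G) (e : G ⟶ F),
      S.Conflation (f ≫ g) k ∧ S.Conflation d e ∧ k ≫ e = g' := by
  obtain ⟨δ, h⟩ := h
  obtain ⟨δ', h'⟩ := h'
  obtain ⟨G, k, d, e, δ'', h₁, -, h₂, h₃, -⟩ := S.ET4 h h'
  exact ⟨G, k, d, e, ⟨_, h₁⟩, ⟨_, h₃⟩, h₂⟩

/-- The octahedral axiom for composed deflations, in terms of conflations. -/
lemma Conflation.octahedron_op {X₁ X₂ X₃ D F : 𝒞} {f' : D ⟶ X₁} {f : X₁ ⟶ X₂} {g' : F ⟶ X₂}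
    {g : X₂ ⟶ X₃} (h : S.Conflation f' f) (h' : S.Conflation g' g) :
    ∃ (G : 𝒞) (k : G ⟶ X₁) (d : D ⟶ G) (e : G ⟶ F),
      S.Conflation k (f ≫ g) ∧ S.Conflation d e := by
  obtain ⟨δ, h⟩ := h
  obtain ⟨δ', h'⟩ := h'
  obtain ⟨G, k, d, e, δ'', h₁, -, -, h₃, -⟩ := S.ET4op h h'
  exact ⟨G, k, d, e, ⟨_, h₁⟩, ⟨_, h₃⟩⟩

end

end Extriangulated

lemma IsExact.conflation {𝒜 : Type u₁} [Category.{v₁} 𝒜] [Preadditive 𝒜] [HasZeroObject 𝒜]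
    [HasBinaryBiproducts 𝒜] {ℬ : Type u₂} [Category.{v₂} ℬ] [Preadditive ℬ] [HasZeroObject ℬ]
    [HasBinaryBiproducts ℬ] {S : Extriangulated.{w₁} 𝒜} {T : Extriangulated.{w₂} ℬ} {F : 𝒜 ⥤ ℬ}
    (hF : IsExact S T F) {X Y Z : 𝒜} {x : X ⟶ Y} {y : Y ⟶ Z} (h : S.Conflation x y) :
    T.Conflation (F.map x) (F.map y) := by
  obtain ⟨η, -, -, hη⟩ := hF.exists_eta
  obtain ⟨δ, h⟩ := h
  exact ⟨_, hη δ x y h⟩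

/-! ### Orthogonality of objects -/

section TorsionPair

variable {𝒞 : Type u} [Category.{v} 𝒞] [Preadditive 𝒞] [HasZeroObject 𝒞] [HasBinaryBiproducts 𝒞]
  {S : Extriangulated.{w} 𝒞}

/-- `𝒞(K, K') = 0` and `𝔼⁻¹(K, K') = 0`: the condition that `DeflOrth` imposes on cocones. -/
def Orth (n : NegFirstExt.{w, w'} S) (K K' : 𝒞) : Prop :=
  (∀ t : K ⟶ K', t = 0) ∧ ∀ e : Ext n.N K K', e = 0

variable {n : NegFirstExt.{w, w'} S}

lemma Orth.of_iso_left {K L K' : 𝒞} (h : Orth n K K') (e : K ≅ L) : Orth n L K' := by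
  refine ⟨fun t => ?_, fun ε => ?_⟩
  · rw [← e.inv_hom_id_assoc t, h.1 (e.hom ≫ t), comp_zero]
  · rw [← pull_id n.N ε, ← e.inv_hom_id, pull_comp, h.2 (pull n.N e.hom ε), map_zero]

lemma Orth.of_iso_right {K K' L : 𝒞} (h : Orth n K K') (e : K' ≅ L) : Orth n K L := by
  refine ⟨fun t => ?_, fun ε => ?_⟩
  · rw [← Category.comp_id t, ← e.inv_hom_id, ← Category.assoc, h.1 (t ≫ e.inv), zero_comp]
  · rw [← push_id n.N ε, ← e.inv_hom_id, push_comp, h.2 (push n.N e.inv ε), map_zero]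

lemma Orth.deflOrth {K K' X Y X' Y' : 𝒞} {l : X ⟶ Y} {r : X' ⟶ Y'} (h : Orth n K K')
    (hK : S.IsCocone K l) (hK' : S.IsCocone K' r) : DeflOrth n l r := by
  intro L L' hL hL'
  obtain ⟨e⟩ := Extriangulated.IsCocone.nonempty_iso hK hL
  obtain ⟨e'⟩ := Extriangulated.IsCocone.nonempty_iso hK' hL'
  exact (h.of_iso_left e).of_iso_right e'

lemma Orth.of_conflation {X Y Z W : 𝒞} {x : X ⟶ Y} {y : Y ⟶ Z} (h : S.Conflation x y)
    (hX : Orth n X W) (hZ : Orth n Z W) : Orth n Y W := by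
  obtain ⟨δ, h⟩ := h
  refine ⟨fun t => ?_, fun ε => ?_⟩
  · obtain ⟨c, rfl⟩ := h.exists_desc t (hX.1 _)
    rw [hZ.1 c, comp_zero]
  · obtain ⟨ε', rfl⟩ := ((n.exact_contra δ x y h W).1 ε).1 (hX.2 _)
    rw [hZ.2 ε', map_zero]

/-- If `y = 0` in a conflation `X ⟶ Y ⟶ Z`, then `𝟙 Z` comes from `𝔼⁻¹(X, Z)`. -/
lemma Orth.isZero_third {X Y Z : 𝒞} {x : X ⟶ Y} {y : Y ⟶ Z} (hXZ : Orth n X Z)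
    (h : S.Conflation x y) (hy : y = 0) : IsZero Z := by
  obtain ⟨δ, h⟩ := h
  obtain ⟨ε, hε⟩ := ((n.exact_contra δ x y h Z).2.2 (𝟙 Z)).1 (by simp [hy])
  rw [IsZero.iff_id_eq_zero, ← hε, hXZ.2 ε, map_zero]

/-- If `x = 0` in a conflation `X ⟶ Y ⟶ Z`, then `𝟙 X` comes from `𝔼⁻¹(X, Z)`. -/
lemma Orth.isZero_first {X Y Z : 𝒞} {x : X ⟶ Y} {y : Y ⟶ Z} (hXZ : Orth n X Z)
    (h : S.Conflation x y) (hx : x = 0) : IsZero X := by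
  obtain ⟨δ, h⟩ := h
  obtain ⟨ε, hε⟩ := ((n.exact_cov δ x y h X).2.2 (𝟙 X)).1 (by simp [hx])
  rw [IsZero.iff_id_eq_zero, ← hε, hXZ.2 ε, map_zero]

/-! ### Torsion pairs and deflation factorization systems -/

/-- A torsion pair relative to a negative first extension structure: the two classes are closed
under isomorphisms, `𝒞(T, F)` and `𝔼⁻¹(T, F)` vanish, and every object is the middle term of a
conflation with outer terms in `T` and `F`. -/
structure IsTorsionPair (n : NegFirstExt.{w, w'} S) (T F : ObjectProperty 𝒞) : Prop where
  closed_left : T.IsClosedUnderIsomorphisms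
  closed_right : F.IsClosedUnderIsomorphisms
  orth : ∀ ⦃X Y : 𝒞⦄, T X → F Y → Orth n X Y
  exists_conflation : ∀ X : 𝒞, ∃ (X₁ X₂ : 𝒞) (x : X₁ ⟶ X) (y : X ⟶ X₂),
    S.Conflation x y ∧ T X₁ ∧ F X₂

/-- The deflations having a cocone in `T`. -/
def deflOfCocone (S : Extriangulated.{w} 𝒞) (T : ObjectProperty 𝒞) : MorphismProperty 𝒞 :=
  fun _ _ f => ∃ K : 𝒞, S.IsCocone K f ∧ T K

lemma deflOfCocone_iff {T : ObjectProperty 𝒞} [T.IsClosedUnderIsomorphisms] {X Y K : 𝒞}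
    {f : X ⟶ Y} (hK : S.IsCocone K f) : deflOfCocone S T f ↔ T K := by
  refine ⟨fun ⟨L, hL, hT⟩ => ?_, fun h => ⟨K, hK, h⟩⟩
  obtain ⟨e⟩ := Extriangulated.IsCocone.nonempty_iso hL hK
  exact T.prop_of_iso e hT

lemma deflOfCocone.deflation {T : ObjectProperty 𝒞} {X Y : 𝒞} {f : X ⟶ Y}
    (h : deflOfCocone S T f) : S.Deflation f := by
  obtain ⟨K, ⟨k, hk⟩, -⟩ := h
  exact ⟨K, k, hk⟩

/-- A torsion pair yields a deflation factorization system: a deflation is factored by applying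
the octahedral axiom to the torsion part of its cocone. -/
theorem IsTorsionPair.isDeflFactSystem {T F : ObjectProperty 𝒞} (h : IsTorsionPair n T F) :
    IsDeflFactSystem n (deflOfCocone S T) (deflOfCocone S F) where
  left_deflation _ _ _ hf := hf.deflation
  right_deflation _ _ _ hf := hf.deflation
  factorization X Y f := by
    rintro ⟨K, k, hk⟩
    obtain ⟨X₁, X₂, x, y, hxy, h₁, h₂⟩ := h.exists_conflation K
    obtain ⟨G, l, d, r, hl, hr, hlr⟩ := hxy.octahedron hk
    exact ⟨G, l, r, ⟨X₁, ⟨_, hl⟩, h₁⟩, ⟨X₂, ⟨_, hr⟩, h₂⟩, hlr.symm⟩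
  left_eq := by
    have := h.closed_left
    ext X Y f
    refine ⟨fun hf => ⟨hf.deflation, ?_⟩, ?_⟩
    · rintro X' Y' g ⟨K', hK', hF⟩
      obtain ⟨K, hK, hT⟩ := hf
      exact (h.orth hT hF).deflOrth hK hK'
    · rintro ⟨⟨K, k, hk⟩, hf⟩
      obtain ⟨X₁, X₂, x, y, hxy, h₁, h₂⟩ := h.exists_conflation K
      have h₀ := S.isCocone_zero X₂ (isZero_zero 𝒞) 0
      have hy := (hf _ ⟨X₂, h₀, h₂⟩ K X₂ ⟨k, hk⟩ h₀).1 y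
      have := hxy.isIso_of_isZero_third ((h.orth h₁ h₂).isZero_third hxy hy)
      exact ⟨K, ⟨k, hk⟩, T.prop_of_iso (asIso x) h₁⟩
  right_eq := by
    have := h.closed_right
    ext X Y f
    refine ⟨?_, fun hf => ⟨hf.deflation, ?_⟩⟩
    · rintro ⟨⟨K, k, hk⟩, hf⟩
      obtain ⟨X₁, X₂, x, y, hxy, h₁, h₂⟩ := h.exists_conflation K
      have h₀ := S.isCocone_zero X₁ (isZero_zero 𝒞) 0
      have hx := (hf _ ⟨X₁, h₀, h₁⟩ X₁ K h₀ ⟨k, hk⟩).1 x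
      have := hxy.isIso_of_isZero_first ((h.orth h₁ h₂).isZero_first hxy hx)
      exact ⟨K, ⟨k, hk⟩, F.prop_of_iso (asIso y).symm h₂⟩
    · rintro X' Y' g ⟨K', hK', hT⟩
      obtain ⟨K, hK, hF⟩ := hf
      exact (h.orth hT hF).deflOrth hK' hK

/-- Every deflation factorization system comes from a torsion pair. Its conflations arise by
factoring the deflations `X ⟶ 0`. -/
theorem IsDeflFactSystem.exists_isTorsionPair {L R : MorphismProperty 𝒞}
    (h : IsDeflFactSystem n L R) : ∃ T F : ObjectProperty 𝒞,
      IsTorsionPair n T F ∧ L = deflOfCocone S T ∧ R = deflOfCocone S F := by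
  let T : ObjectProperty 𝒞 := fun K =>
    ∀ ⦃X Y K' : 𝒞⦄ (g : X ⟶ Y), R g → S.IsCocone K' g → Orth n K K'
  let F : ObjectProperty 𝒞 := fun K' =>
    ∀ ⦃X Y K : 𝒞⦄ (f : X ⟶ Y), L f → S.IsCocone K f → Orth n K K'
  have hT : ∀ {X Y K : 𝒞} {f : X ⟶ Y}, L f → S.IsCocone K f → T K := by
    intro X Y K f hf hK X' Y' K' g hg hK'
    rw [h.left_eq] at hf
    exact hf.2 g hg K K' hK hK'
  have hF : ∀ {X Y K : 𝒞} {g : X ⟶ Y}, R g → S.IsCocone K g → F K := by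
    intro X Y K g hg hK X' Y' K' f hf hK'
    rw [← h.right_eq] at hg
    exact hg.2 f hf K' K hK' hK
  have hL : L = deflOfCocone S T := by
    ext X Y f
    constructor
    · intro hf
      obtain ⟨K, k, hk⟩ := h.left_deflation f hf
      exact ⟨K, ⟨k, hk⟩, hT hf ⟨k, hk⟩⟩
    · intro hf
      rw [h.left_eq]
      refine ⟨hf.deflation, fun X' Y' g hg => ?_⟩
      obtain ⟨K, hK, hTK⟩ := hf
      obtain ⟨K', k', hk'⟩ := h.right_deflation g hg
      exact (hTK g hg ⟨k', hk'⟩).deflOrth hK ⟨k', hk'⟩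
  have hR : R = deflOfCocone S F := by
    ext X Y g
    constructor
    · intro hg
      obtain ⟨K, k, hk⟩ := h.right_deflation g hg
      exact ⟨K, ⟨k, hk⟩, hF hg ⟨k, hk⟩⟩
    · intro hg
      rw [← h.right_eq]
      refine ⟨hg.deflation, fun X' Y' f hf => ?_⟩
      obtain ⟨K, hK, hFK⟩ := hg
      obtain ⟨K', k', hk'⟩ := h.left_deflation f hf
      exact (hFK f hf ⟨k', hk'⟩).deflOrth ⟨k', hk'⟩ hK
  refine ⟨T, F, ⟨⟨fun e hX _ _ _ g hg hK => (hX g hg hK).of_iso_left e⟩,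
    ⟨fun e hX _ _ _ f hf hK => (hX f hf hK).of_iso_right e⟩, fun X Y hX hY => ?_, fun X => ?_⟩,
    hL, hR⟩
  · have h₀ := S.isCocone_zero X (isZero_zero 𝒞) 0
    exact hY (0 : X ⟶ 0) (by rw [hL]; exact ⟨X, h₀, hX⟩) h₀
  · have h₀ := S.isCocone_zero X (isZero_zero 𝒞) 0
    obtain ⟨M, l, r, hl, hr, -⟩ := h.factorization (0 : X ⟶ 0) ⟨X, h₀⟩
    obtain ⟨K, k, hk⟩ := h.left_deflation l hl
    exact ⟨K, M, k, l, hk, hT hl ⟨k, hk⟩, hF hr (S.isCocone_zero M (isZero_zero 𝒞) r)⟩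

end TorsionPair

/-! ### Orthogonality and adjunctions -/

/-- If `F ⊣ G` with `G` exact, orthogonality passes from `(A, G Y)` to `(F A, Y)`. For a conflation
`Y' ⟶ P ⟶ Y` with `P` projective, balancedness embeds `𝔼⁻¹(F A, Y)` into the kernel of
`ℬ(F A, Y') ⟶ ℬ(F A, P)`, and the adjunction identifies this kernel with a quotient of
`𝔼⁻¹(A, G Y) = 0`. -/
lemma Orth.of_adjunction {𝒜 : Type u₁} [Category.{v₁} 𝒜] [Preadditive 𝒜] [HasZeroObject 𝒜]
    [HasBinaryBiproducts 𝒜] {ℬ : Type u₂} [Category.{v₂} ℬ] [Preadditive ℬ] [HasZeroObject ℬ]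
    [HasBinaryBiproducts ℬ] {SA : Extriangulated.{w₁} 𝒜} {SB : Extriangulated.{w₂} ℬ}
    {nA : NegFirstExt.{w₁, w₁'} SA} {nB : NegFirstExt.{w₂, w₂'} SB} (hB : nB.Balanced)
    (hproj : SB.EnoughProjectives) {F : 𝒜 ⥤ ℬ} {G : ℬ ⥤ 𝒜} (adj : F ⊣ G) (hG : IsExact SB SA G)
    {A : 𝒜} {Y : ℬ} (h : Orth nA A (G.obj Y)) : Orth nB (F.obj A) Y := by
  have := hG.additive
  have hzero : ∀ {W : ℬ} (t : F.obj A ⟶ W), adj.homEquiv A W t = 0 → t = 0 := fun t ht =>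
    (adj.homEquiv _ _).injective (by rw [ht, adj.homEquiv_unit, G.map_zero, comp_zero])
  refine ⟨fun t => hzero t (h.1 _), fun ε => ?_⟩
  obtain ⟨Y', P, x, y, ⟨δ, hδ⟩, hP⟩ := hproj Y
  obtain ⟨η, -, -, hη⟩ := hG.exists_eta
  have h₀ : nB.sharpCov δ (F.obj A) ε = 0 := by
    refine hzero _ ?_
    have hx : nB.sharpCov δ (F.obj A) ε ≫ x = 0 :=
      ((nB.exact_cov δ x y hδ (F.obj A)).2.2 _).2 ⟨ε, rfl⟩
    obtain ⟨ε', hε'⟩ := ((nA.exact_cov _ _ _ (hη δ x y hδ) A).2.2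
      (adj.homEquiv A Y' (nB.sharpCov δ (F.obj A) ε))).1
        (by
          change _ ≫ G.map x = 0
          rw [← adj.homEquiv_naturality_right, hx, adj.homEquiv_unit, G.map_zero, comp_zero])
    rw [← hε', h.2 ε', map_zero]
  obtain ⟨ε', rfl⟩ := ((nB.exact_cov δ x y hδ (F.obj A)).2.1 ε).1 h₀
  rw [hB _ _ hP ε', map_zero]

/-! ### Recollements with exact `i^*` and `i^!` -/

namespace Recollement

variable {𝒜 : Type u₁} [Category.{v₁} 𝒜] [Preadditive 𝒜] [HasZeroObject 𝒜] [HasBinaryBiproducts 𝒜]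
  {ℬ : Type u₂} [Category.{v₂} ℬ] [Preadditive ℬ] [HasZeroObject ℬ] [HasBinaryBiproducts ℬ]
  {𝒞 : Type u₃} [Category.{v₃} 𝒞] [Preadditive 𝒞] [HasZeroObject 𝒞] [HasBinaryBiproducts 𝒞]
  {SA : Extriangulated.{w₁} 𝒜} {SB : Extriangulated.{w₂} ℬ} {SC : Extriangulated.{w₃} 𝒞}
  (R : Recollement SA SB SC)

lemma isZero_jStar_iLower (A : 𝒜) : IsZero (R.jStar.obj (R.iLower.obj A)) :=
  (R.im_eq_ker _).1 ⟨A, ⟨Iso.refl _⟩⟩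

lemma isZero_iStar_jShriek (C : 𝒞) : IsZero (R.iStar.obj (R.jShriek.obj C)) := by
  rw [IsZero.iff_id_eq_zero]
  apply (R.adj_iStar.homEquiv _ _).injective
  apply (R.adj_jShriek.homEquiv _ _).injective
  exact (R.isZero_jStar_iLower _).eq_of_tgt _ _

lemma isZero_iShriek_jLower (C : 𝒞) : IsZero (R.iShriek.obj (R.jLower.obj C)) := by
  rw [IsZero.iff_id_eq_zero]
  apply (R.adj_iShriek.homEquiv _ _).symm.injective
  apply (R.adj_jLower.homEquiv _ _).symm.injective
  exact (R.isZero_jStar_iLower _).eq_of_src _ _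

lemma isIso_counit_iStar (A : 𝒜) : IsIso (R.adj_iStar.counit.app A) := by
  have := R.full_iLower
  have := R.faithful_iLower
  infer_instance

lemma isIso_unit_iShriek (A : 𝒜) : IsIso (R.adj_iShriek.unit.app A) := by
  have := R.full_iLower
  have := R.faithful_iLower
  infer_instance

lemma isIso_counit_jLower (C : 𝒞) : IsIso (R.adj_jLower.counit.app C) := by
  have := R.full_jLower
  have := R.faithful_jLower
  infer_instance

lemma nonempty_iStar_iLower_iso (A : 𝒜) : Nonempty (R.iStar.obj (R.iLower.obj A) ≅ A) := by
  have := R.isIso_counit_iStar A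
  exact ⟨asIso (R.adj_iStar.counit.app A)⟩

lemma nonempty_iShriek_iLower_iso (A : 𝒜) : Nonempty (R.iShriek.obj (R.iLower.obj A) ≅ A) := by
  have := R.isIso_unit_iShriek A
  exact ⟨(asIso (R.adj_iShriek.unit.app A)).symm⟩

lemma nonempty_jStar_jLower_iso (C : 𝒞) : Nonempty (R.jStar.obj (R.jLower.obj C) ≅ C) := by
  have := R.isIso_counit_jLower C
  exact ⟨asIso (R.adj_jLower.counit.app C)⟩

lemma isZero_iLower_of_isZero {A : 𝒜} (hA : IsZero A) : IsZero (R.iLower.obj A) := by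
  have := R.exact_iLower.additive
  exact R.iLower.map_isZero hA

/-- If `i^*` is exact, the right exact sequence of the recollement at `X` becomes a conflation
`j_! j^* X ⟶ X ⟶ i_* i^* X`. -/
lemma exists_conflation_unit_iStar (h : IsExact SB SA R.iStar) (X : ℬ) :
    ∃ (K : ℬ) (k : K ⟶ X), SB.Conflation k (R.adj_iStar.unit.app X) ∧
      Nonempty (R.jShriek.obj (R.jStar.obj X) ≅ K) := by
  obtain ⟨A, a, K, g₁, g₂, h₁, h₂, -, -⟩ := R.rightSeq X
  refine ⟨K, g₂, h₂, ?_⟩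
  have hK : IsZero (R.iStar.obj K) := by
    have := R.isIso_counit_iStar (R.iStar.obj X)
    have : IsIso (R.iStar.map (R.adj_iStar.unit.app X)) :=
      IsIso.of_isIso_fac_right (hh := IsIso.id _) (R.adj_iStar.left_triangle_components X)
    exact (h.conflation h₂).isZero_first
  have hA : IsZero A := by
    have := (R.isZero_iStar_jShriek _).isIso hK (R.iStar.map g₁)
    obtain ⟨e⟩ := R.nonempty_iStar_iLower_iso A
    exact (h.conflation h₁).isZero_first.of_iso e.symm
  have := h₁.isIso_of_isZero_first (R.isZero_iLower_of_isZero hA)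
  exact ⟨asIso g₁⟩

/-- If `i^!` is exact, the left exact sequence of the recollement at `X` becomes a conflation
`i_* i^! X ⟶ X ⟶ j_* j^* X`. -/
lemma exists_conflation_counit_iShriek (h : IsExact SB SA R.iShriek) (X : ℬ) :
    ∃ (K : ℬ) (k : X ⟶ K), SB.Conflation (R.adj_iShriek.counit.app X) k ∧
      Nonempty (K ≅ R.jLower.obj (R.jStar.obj X)) := by
  obtain ⟨A, a, K, g₁, g₂, h₁, h₂, -, -⟩ := R.leftSeq X
  refine ⟨K, g₁, h₁, ?_⟩
  have hK : IsZero (R.iShriek.obj K) := by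
    have := R.isIso_unit_iShriek (R.iShriek.obj X)
    have : IsIso (R.iShriek.map (R.adj_iShriek.counit.app X)) :=
      IsIso.of_isIso_fac_left (hh := IsIso.id _) (R.adj_iShriek.right_triangle_components X)
    exact (h.conflation h₁).isZero_third
  have hA : IsZero A := by
    have := hK.isIso (R.isZero_iShriek_jLower _) (R.iShriek.map g₂)
    obtain ⟨e⟩ := R.nonempty_iShriek_iLower_iso A
    exact (h.conflation h₂).isZero_third.of_iso e.symm
  have := h₂.isIso_of_isZero_third (R.isZero_iLower_of_isZero hA)
  exact ⟨asIso g₂⟩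

/-- If `i^!` is exact, the image under `j_*` of an inflation with cone `Z` is an inflation whose
cone `Q` satisfies `i^! Q = 0` and `j^* Q ≅ Z`. -/
lemma exists_conflation_jLower (h : IsExact SB SA R.iShriek) {X Y Z : 𝒞} {x : X ⟶ Y} {y : Y ⟶ Z}
    (hxy : SC.Conflation x y) :
    ∃ (Q : ℬ) (q : R.jLower.obj Y ⟶ Q), SB.Conflation (R.jLower.map x) q ∧
      IsZero (R.iShriek.obj Q) ∧ Nonempty (R.jStar.obj Q ≅ Z) := by
  obtain ⟨Q, q, _, hq, -⟩ := R.leftExact_jLower.leftExactSeq x y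
    ⟨Z, y, 𝟙 Z, hxy, ⟨0, 0, 0, SC.realizes_id_zero Z (isZero_zero 𝒞)⟩,
      fun _ _ => inferInstance, by simp⟩
  refine ⟨Q, q, hq, ?_, ?_⟩
  · have := (R.isZero_iShriek_jLower _).isIso (R.isZero_iShriek_jLower _)
      (R.iShriek.map (R.jLower.map x))
    exact (h.conflation hq).isZero_third
  · have := R.isIso_counit_jLower X
    have := R.isIso_counit_jLower Y
    exact (R.exact_jStar.conflation hq).nonempty_iso_third hxy
      (asIso (R.adj_jLower.counit.app X)) (asIso (R.adj_jLower.counit.app Y))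
      (R.adj_jLower.counit.naturality x)

/-! ### Gluing torsion pairs -/

/-- Torsion pairs in the outer terms of a recollement glue to a torsion pair in the middle term. -/
theorem isTorsionPair {nA : NegFirstExt.{w₁, w₁'} SA} {nB : NegFirstExt.{w₂, w₂'} SB}
    {nC : NegFirstExt.{w₃, w₃'} SC} (hB : nB.Balanced) (hproj : SB.EnoughProjectives)
    (hiStar : IsExact SB SA R.iStar) (hiShriek : IsExact SB SA R.iShriek)
    {T₁ F₁ : ObjectProperty 𝒜} (h₁ : IsTorsionPair nA T₁ F₁)
    {T₂ F₂ : ObjectProperty 𝒞} (h₂ : IsTorsionPair nC T₂ F₂) :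
    IsTorsionPair nB (fun X => T₁ (R.iStar.obj X) ∧ T₂ (R.jStar.obj X))
      (fun X => F₁ (R.iShriek.obj X) ∧ F₂ (R.jStar.obj X)) := by
  have := h₁.closed_left
  have := h₁.closed_right
  have := h₂.closed_left
  have := h₂.closed_right
  refine ⟨⟨fun e h => ⟨T₁.prop_of_iso (R.iStar.mapIso e) h.1,
      T₂.prop_of_iso (R.jStar.mapIso e) h.2⟩⟩,
    ⟨fun e h => ⟨F₁.prop_of_iso (R.iShriek.mapIso e) h.1,
      F₂.prop_of_iso (R.jStar.mapIso e) h.2⟩⟩, fun X Y hX hY => ?_, fun B => ?_⟩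
  · obtain ⟨K, k, hk, ⟨e⟩⟩ := R.exists_conflation_unit_iStar hiStar X
    have hj := Orth.of_adjunction hB hproj R.adj_jShriek R.exact_jStar (h₂.orth hX.2 hY.2)
    have hi := Orth.of_adjunction hB hproj R.adj_iShriek hiShriek (h₁.orth hX.1 hY.1)
    exact Orth.of_conflation hk (hj.of_iso_left e) hi
  -- `Y` is a cocone of `B ⟶ j_* j^* B ⟶ Q`, where `Q` extends the torsion-free part of `j^* B`.
  obtain ⟨C₁, C₂, c₁, c₂, hc, hT₂, hF₂⟩ := h₂.exists_conflation (R.jStar.obj B)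
  obtain ⟨Q, q, ⟨δ, hq⟩, hQ, ⟨eQ⟩⟩ := R.exists_conflation_jLower hiShriek hc
  obtain ⟨K, k, hk, ⟨e⟩⟩ := R.exists_conflation_counit_iShriek hiShriek B
  have hq' : SB.Conflation (R.jLower.map c₁ ≫ e.inv) (e.hom ≫ q) :=
    ⟨δ, SB.realizes_of_equiv e.symm hq rfl (by simp)⟩
  obtain ⟨Y, y, d, d', hy, hd⟩ := hk.octahedron_op hq'
  have hjY : T₂ (R.jStar.obj Y) := by
    have := (R.exact_jStar.conflation hd).isIso_of_isZero_first (R.isZero_jStar_iLower _)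
    obtain ⟨e₁⟩ := R.nonempty_jStar_jLower_iso C₁
    exact T₂.prop_of_iso ((asIso (R.jStar.map d')).trans e₁).symm hT₂
  -- `X` is a cocone of `Y ⟶ i_* i^* Y ⟶ i_* A₂`, where `A₂` is the torsion-free part of `i^* Y`.
  obtain ⟨A₁, A₂, a₁, a₂, ha, hT₁, hF₁⟩ := h₁.exists_conflation (R.iStar.obj Y)
  obtain ⟨K', k', hk', ⟨e'⟩⟩ := R.exists_conflation_unit_iStar hiStar Y
  obtain ⟨X, x, f, f', hx, hf⟩ := hk'.octahedron_op (R.exact_iLower.conflation ha)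
  obtain ⟨G, p, g, g', hp, hg, -⟩ := hx.octahedron hy
  refine ⟨X, G, x ≫ y, p, hp, ⟨?_, ?_⟩, ⟨?_, ?_⟩⟩
  · have := (hiStar.conflation hf).isIso_of_isZero_first
      ((R.isZero_iStar_jShriek _).of_iso (R.iStar.mapIso e').symm)
    obtain ⟨e₁⟩ := R.nonempty_iStar_iLower_iso A₁
    exact T₁.prop_of_iso ((asIso (R.iStar.map f')).trans e₁).symm hT₁
  · have := (R.exact_jStar.conflation hx).isIso_of_isZero_third (R.isZero_jStar_iLower _)
    exact T₂.prop_of_iso (asIso (R.jStar.map x)).symm hjY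
  · have := (hiShriek.conflation hg).isIso_of_isZero_third hQ
    obtain ⟨e₁⟩ := R.nonempty_iShriek_iLower_iso A₂
    exact F₁.prop_of_iso (e₁.symm.trans (asIso (R.iShriek.map g))) hF₁
  · have := (R.exact_jStar.conflation hg).isIso_of_isZero_first (R.isZero_jStar_iLower _)
    exact F₂.prop_of_iso ((asIso (R.jStar.map g')).trans eQ).symm hF₂

end Recollement

end Extri

theorem theorem4p6
    {𝒜 : Type u₁} [Category.{v₁} 𝒜] [Preadditive 𝒜] [HasZeroObject 𝒜] [HasBinaryBiproducts 𝒜]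
    {ℬ : Type u₂} [Category.{v₂} ℬ] [Preadditive ℬ] [HasZeroObject ℬ] [HasBinaryBiproducts ℬ]
    {𝒞 : Type u₃} [Category.{v₃} 𝒞] [Preadditive 𝒞] [HasZeroObject 𝒞] [HasBinaryBiproducts 𝒞]
    (SA : Extri.Extriangulated.{w₁} 𝒜) (SB : Extri.Extriangulated.{w₂} ℬ)
    (SC : Extri.Extriangulated.{w₃} 𝒞)
    (nA : Extri.NegFirstExt.{w₁, w₁'} SA) (nB : Extri.NegFirstExt.{w₂, w₂'} SB)
    (nC : Extri.NegFirstExt.{w₃, w₃'} SC)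
    (hA : nA.Balanced) (hB : nB.Balanced) (hC : nC.Balanced)
    (hproj : SB.EnoughProjectives)
    (R : Extri.Recollement SA SB SC)
    (E₁ M₁ : MorphismProperty 𝒜) (h₁ : Extri.IsDeflFactSystem nA E₁ M₁)
    (E₂ M₂ : MorphismProperty 𝒞) (h₂ : Extri.IsDeflFactSystem nC E₂ M₂)
    (hiStar : Extri.IsExact SB SA R.iStar) (hiShriek : Extri.IsExact SB SA R.iShriek)
    (hpres : Extri.PreservesProjectives SB SA R.iShriek) :
    Extri.IsDeflFactSystem nB
      (fun _ _ f => SB.Deflation f ∧ E₁ (R.iStar.map f) ∧ E₂ (R.jStar.map f))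
      (fun _ _ g => SB.Deflation g ∧ M₁ (R.iShriek.map g) ∧ M₂ (R.jStar.map g)) := by
  obtain ⟨T₁, F₁, t₁, rfl, rfl⟩ := h₁.exists_isTorsionPair
  obtain ⟨T₂, F₂, t₂, rfl, rfl⟩ := h₂.exists_isTorsionPair
  have := t₁.closed_left
  have := t₁.closed_right
  have := t₂.closed_left
  have := t₂.closed_right
  have t := R.isTorsionPair hB hproj hiStar hiShriek t₁ t₂
  -- Exact functors preserve cocones, so membership in either class is a property of the cocone.
  have hE : (fun _ _ f => SB.Deflation f ∧ Extri.deflOfCocone SA T₁ (R.iStar.map f) ∧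
      Extri.deflOfCocone SC T₂ (R.jStar.map f)) = Extri.deflOfCocone SB
        (fun X => T₁ (R.iStar.obj X) ∧ T₂ (R.jStar.obj X)) := by
    ext X Y f
    refine ⟨?_, fun hf => ⟨hf.deflation, ?_⟩⟩
    · rintro ⟨⟨K, k, hk⟩, hf₁, hf₂⟩
      exact ⟨K, ⟨k, hk⟩, (Extri.deflOfCocone_iff ⟨_, hiStar.conflation hk⟩).1 hf₁,
        (Extri.deflOfCocone_iff ⟨_, R.exact_jStar.conflation hk⟩).1 hf₂⟩
    · obtain ⟨K, ⟨k, hk⟩, hK₁, hK₂⟩ := hf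
      exact ⟨⟨_, ⟨_, hiStar.conflation hk⟩, hK₁⟩, ⟨_, ⟨_, R.exact_jStar.conflation hk⟩, hK₂⟩⟩
  have hM : (fun _ _ g => SB.Deflation g ∧ Extri.deflOfCocone SA F₁ (R.iShriek.map g) ∧
      Extri.deflOfCocone SC F₂ (R.jStar.map g)) = Extri.deflOfCocone SB
        (fun X => F₁ (R.iShriek.obj X) ∧ F₂ (R.jStar.obj X)) := by
    ext X Y g
    refine ⟨?_, fun hg => ⟨hg.deflation, ?_⟩⟩
    · rintro ⟨⟨K, k, hk⟩, hg₁, hg₂⟩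
      exact ⟨K, ⟨k, hk⟩, (Extri.deflOfCocone_iff ⟨_, hiShriek.conflation hk⟩).1 hg₁,
        (Extri.deflOfCocone_iff ⟨_, R.exact_jStar.conflation hk⟩).1 hg₂⟩
    · obtain ⟨K, ⟨k, hk⟩, hK₁, hK₂⟩ := hg
      exact ⟨⟨_, ⟨_, hiShriek.conflation hk⟩, hK₁⟩, ⟨_, ⟨_, R.exact_jStar.conflation hk⟩, hK₂⟩⟩
  rw [hE, hM]
  exact t.isDeflFactSystem
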